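/- Let $PG(2,11)$ be the Desarguesian projective plane over the field with $11$ elements. A set $\mathcal S$ of points of a projective plane is a blocking set if every line meets $\mathcal S$ in at least one point but $\mathcal S$ contains no line; it is a semioval if at each point $P\in\mathcal S$ there is a unique tangent line, that is, a unique line $\ell$ with $\ell\cap\mathcal S=\{P\}$; and it is a blocking semioval if it is both a blocking set and a semioval. Theorem. There is no blocking semioval with exactly $25$ points in $PG(2,11)$. Moreover, the smallest size of a blocking semioval in $PG(2,11)$ is $26$: there is a blocking semioval with $26$ points, and none with fewer. -/

import Mathlib

open scoped LinearAlgebra.Projectivization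

instance fact_prime_eleven : Fact (Nat.Prime 11) := ⟨by norm_num⟩

section BlockingSemiovals

variable (P L : Type*) [Membership P L]

variable {P L} in
/-- The line `l` is tangent to the point set `S` at `p`: it meets `S` in `p` and in no other
point. -/
def IsTangentAt (S : Set P) (l : L) (p : P) : Prop :=
  {x | x ∈ S ∧ x ∈ l} = {p}

/-- A blocking set of the plane with points `P` and lines `L`: every line meets `S`, and `S`
contains no line. -/
def IsBlockingSet (S : Set P) : Prop :=
  (∀ l : L, ∃ x ∈ S, x ∈ l) ∧ ∀ l : L, ∃ x, x ∈ l ∧ x ∉ S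

/-- A semioval: there is a unique tangent line at each of its points. -/
def IsSemioval (S : Set P) : Prop :=
  ∀ p ∈ S, ∃! l : L, IsTangentAt S l p

/-- A blocking semioval is a set of points that is both a blocking set and a semioval. -/
def IsBlockingSemioval (S : Set P) : Prop :=
  IsBlockingSet P L S ∧ IsSemioval P L S

end BlockingSemiovals

/-- The points of `PG(2,11)`, as classes `(x, y, z)` of homogeneous coordinates over the field with
eleven elements. -/
abbrev PG211.Point : Type := ℙ (ZMod 11) (Fin 3 → ZMod 11)

/-- The lines of `PG(2,11)`, as classes `[a, b, c]` of homogeneous line coordinates. The incidence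
`p ∈ l` of Mathlib, `Configuration.ofField`, says that `a * x + b * y + c * z = 0`. -/
abbrev PG211.Line : Type := ℙ (ZMod 11) (Fin 3 → ZMod 11)

/-! Write k for the size of a blocking semioval S, q = 11, and give an m-secant the excess m - 2,
truncated to 0 on tangents. Since S has exactly k tangents, standard double counting determines the
sum of the excesses and the sum of their squares. For small k the squares are too large unless long
secants exist, so the point is to bound secants. Two bounds do this. Replacing the points of S on an
m-secant by about m/2 points off it blocks the affine plane, so Jamison's theorem gives m + 41 ≤ 2k
(`secantSize_add_le`). Also, a point off S on a long secant lies on many tangents, while only k - m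
tangents meet the secant off S (`secantSize_mul_le`). Together they exclude k < 25. For k = 25 they
leave m ≤ 6. Any two 6-secants then meet in S, and counting incidences with 6-secants and 3-secants
is contradictory (`card_ne_twentyfive`). For 26 an explicit set is checked by computation. -/

open Configuration Finset

open scoped Classical in
/-- The number of points of `S` on the line `l`. -/
noncomputable def secantSize {P L : Type*} [Membership P L] (S : Finset P) (l : L) : ℕ :=
  #{x ∈ S | x ∈ l}

open scoped Classical in
/-- The number of lines through `p` that meet `S` in exactly one point. -/
noncomputable def tangentCount {P L : Type*} [Membership P L] [Fintype L] (S : Finset P)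
    (p : P) : ℕ :=
  #{l : L | p ∈ l ∧ secantSize S l = 1}

/-! ### Double counting in a finite projective plane -/

section Counting

open scoped Classical

variable {P L : Type*} [Membership P L]

theorem isTangentAt_iff {S : Finset P} {l : L} {p : P} :
    IsTangentAt (S : Set P) l p ↔ p ∈ S ∧ p ∈ l ∧ secantSize S l = 1 := by
  have key : {x | x ∈ (S : Set P) ∧ x ∈ l} = ((S.filter (· ∈ l) : Finset P) : Set P) := by
    ext x; simp
  rw [IsTangentAt, key, ← coe_singleton, coe_inj, secantSize, card_eq_one]
  constructor
  · intro h
    have hp : p ∈ S.filter (· ∈ l) := by rw [h]; exact mem_singleton_self p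
    exact ⟨(mem_filter.1 hp).1, (mem_filter.1 hp).2, p, h⟩
  · rintro ⟨h1, h2, a, ha⟩
    have hp : p ∈ S.filter (· ∈ l) := mem_filter.2 ⟨h1, h2⟩
    rw [ha, mem_singleton] at hp
    rw [ha, hp]

theorem sum_secantSize (S : Finset P) (M : Finset L) :
    ∑ l ∈ M, secantSize S l = ∑ x ∈ S, #{l ∈ M | x ∈ l} :=
  sum_card_bipartiteAbove_eq_sum_card_bipartiteBelow (fun (l : L) (x : P) => x ∈ l)

/-- Truncation turns the excess -1 of a tangent into 0; the last term is this correction. -/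
theorem sum_secantSize_sub_two {S : Finset P} (hS : ∀ l : L, 1 ≤ secantSize S l)
    (M : Finset L) :
    ∑ l ∈ M, (secantSize S l - 2) + 2 * #M =
      ∑ l ∈ M, secantSize S l + #{l ∈ M | secantSize S l = 1} := by
  rw [card_filter, ← sum_add_distrib, mul_comm, ← smul_eq_mul, ← sum_const, ← sum_add_distrib]
  refine sum_congr rfl fun l _ => ?_
  have := hS l
  split_ifs <;> omega

variable [Fintype L]

theorem sum_card_secants_through (S : Finset P) (j : ℕ) :
    ∑ p ∈ S, #{l : L | p ∈ l ∧ secantSize S l = j} = #{l : L | secantSize S l = j} * j := by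
  have h1 := sum_secantSize S ({l : L | secantSize S l = j} : Finset L)
  rw [sum_congr rfl (g := fun _ => j) (fun l hl => (mem_filter.1 hl).2), sum_const,
    smul_eq_mul] at h1
  rw [h1]
  refine sum_congr rfl fun p _ => ?_
  rw [filter_filter]
  simp only [and_comm]

theorem tangentCount_eq_one {S : Finset P} (h : IsSemioval P L (S : Set P)) {p : P}
    (hp : p ∈ S) : tangentCount (L := L) S p = 1 := by
  obtain ⟨l, hl, hu⟩ := h p (mem_coe.2 hp)
  rw [tangentCount, card_eq_one]
  refine ⟨l, ?_⟩
  ext m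
  simp only [mem_filter, mem_univ, true_and, mem_singleton]
  constructor
  · exact fun hm => hu m (isTangentAt_iff.2 ⟨hp, hm⟩)
  · rintro rfl
    exact (isTangentAt_iff.1 hl).2

/-- A semioval has as many tangents as points. -/
theorem card_tangents {S : Finset P} (h : IsSemioval P L (S : Set P)) :
    #{l : L | secantSize S l = 1} = #S := by
  have h1 := sum_secantSize S ({l : L | secantSize S l = 1} : Finset L)
  rw [sum_congr rfl (g := fun _ => 1) (fun l hl => (mem_filter.1 hl).2)] at h1
  rw [card_eq_sum_ones, h1, card_eq_sum_ones]
  refine sum_congr rfl fun x hx => ?_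
  rw [filter_filter]
  simpa only [and_comm, tangentCount] using tangentCount_eq_one h hx

variable [ProjectivePlane P L]

theorem card_lines_through_two {p x : P} (h : x ≠ p) : #{l : L | p ∈ l ∧ x ∈ l} = 1 := by
  obtain ⟨l, hl, hu⟩ := HasLines.existsUnique_line P L x p h
  rw [card_eq_one]
  refine ⟨l, ?_⟩
  ext m
  simp only [mem_filter, mem_univ, true_and, mem_singleton]
  exact ⟨fun hm => hu m ⟨hm.2, hm.1⟩, by rintro rfl; exact ⟨hl.2, hl.1⟩⟩

variable [Fintype P]

theorem card_lines_through (p : P) : #{l : L | p ∈ l} = ProjectivePlane.order P L + 1 := by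
  rw [← ProjectivePlane.lineCount_eq (L := L) p, lineCount, Nat.card_eq_fintype_card,
    Fintype.card_subtype]

theorem card_points_on (l : L) : #{p : P | p ∈ l} = ProjectivePlane.order P L + 1 := by
  rw [← ProjectivePlane.pointCount_eq P l, pointCount, Nat.card_eq_fintype_card,
    Fintype.card_subtype]

theorem sum_secantSize_through (S : Finset P) (p : P) :
    ∑ l : L with p ∈ l, secantSize S l =
      #S + if p ∈ S then ProjectivePlane.order P L else 0 := by
  have h1 : ∀ x ∈ S, #{l ∈ ({l : L | p ∈ l} : Finset L) | x ∈ l} =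
      1 + if p = x then ProjectivePlane.order P L else 0 := by
    intro x _
    rw [filter_filter]
    split_ifs with h
    · subst h
      simp only [and_self, card_lines_through]
      omega
    · rw [card_lines_through_two (Ne.symm h)]
  rw [sum_secantSize, sum_congr rfl h1, sum_add_distrib]
  simp

theorem sum_secantSize_univ (S : Finset P) :
    ∑ l : L, secantSize S l = #S * (ProjectivePlane.order P L + 1) := by
  rw [sum_secantSize]
  simp [card_lines_through]

theorem sum_secantSize_sq (S : Finset P) :
    ∑ l : L, secantSize S l ^ 2 = #S * (#S + ProjectivePlane.order P L) := by
  have h1 : ∑ l : L, secantSize S l ^ 2 = ∑ p ∈ S, ∑ l : L with p ∈ l, secantSize S l := by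
    rw [sum_comm' (t' := univ) (s' := fun l => {p ∈ S | p ∈ l}) (by simp)]
    simp [secantSize, sq]
  rw [h1, sum_congr rfl (fun p hp => by rw [sum_secantSize_through, if_pos hp]), sum_const,
    smul_eq_mul]

theorem sum_excess_through {S : Finset P} (hS : ∀ l : L, 1 ≤ secantSize S l) (p : P) :
    ∑ l : L with p ∈ l, (secantSize S l - 2) + 2 * (ProjectivePlane.order P L + 1) =
      #S + (if p ∈ S then ProjectivePlane.order P L else 0) + tangentCount (L := L) S p := by
  rw [← sum_secantSize_through (L := L) S p, ← card_lines_through (L := L) p,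
    sum_secantSize_sub_two hS, filter_filter, tangentCount]

/-- A long secant through a point off S must be compensated by tangents through that point. -/
theorem excess_le {S : Finset P} (hS : ∀ l : L, 1 ≤ secantSize S l) {p : P} (hp : p ∉ S)
    {l : L} (hl : p ∈ l) :
    (secantSize S l - 2) + 2 * (ProjectivePlane.order P L + 1) ≤
      #S + tangentCount (L := L) S p := by
  have h := sum_excess_through hS p
  rw [if_neg hp] at h
  have h2 := single_le_sum (f := fun l : L => secantSize S l - 2) (fun _ _ => Nat.zero_le _)
    (mem_filter.2 ⟨mem_univ l, hl⟩ : l ∈ ({l : L | p ∈ l} : Finset L))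
  omega

theorem sum_excess {S : Finset P} (hS : ∀ l : L, 1 ≤ secantSize S l)
    (h : IsSemioval P L (S : Set P)) :
    ∑ l : L, (secantSize S l - 2) + 2 * Fintype.card L =
      #S * (ProjectivePlane.order P L + 2) := by
  have := sum_secantSize_sub_two hS univ
  rw [card_tangents h, sum_secantSize_univ, card_univ] at this
  rw [this]; ring

theorem sum_excess_sq {S : Finset P} (hS : ∀ l : L, 1 ≤ secantSize S l)
    (h : IsSemioval P L (S : Set P)) :
    ∑ l : L, (secantSize S l - 2) ^ 2 + 4 * ∑ l : L, (secantSize S l - 2) + 4 * Fintype.card L =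
      #S * (#S + ProjectivePlane.order P L + 3) := by
  -- The square expands as usual, except on a tangent, where truncation gives 4 = 1 + 3.
  have h1 : ∑ l : L, ((secantSize S l - 2) ^ 2 + 4 * (secantSize S l - 2) + 4) =
      ∑ l : L, (secantSize S l ^ 2 + 3 * if secantSize S l = 1 then 1 else 0) := by
    refine sum_congr rfl fun l _ => ?_
    split_ifs with hl
    · simp [hl]
    · obtain ⟨j, hj⟩ := Nat.exists_eq_add_of_le (show 2 ≤ secantSize S l by have := hS l; omega)
      rw [hj, Nat.add_sub_cancel_left]
      ring
  simp only [sum_add_distrib, ← mul_sum, sum_const, card_univ, smul_eq_mul, sum_secantSize_sq,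
    ← card_filter, card_tangents h] at h1
  linarith

/-- The tangents meet a line that is not a tangent in its points. -/
theorem sum_tangentCount {S : Finset P} (h : IsSemioval P L (S : Set P)) {l : L}
    (hl : secantSize S l ≠ 1) :
    ∑ p : P with p ∈ l ∧ p ∉ S, tangentCount (L := L) S p + secantSize S l = #S := by
  have h1 : ∀ A : Finset P, ∑ p ∈ A, tangentCount (L := L) S p =
      ∑ m : L with secantSize S m = 1, #{p ∈ A | p ∈ m} := by
    intro A
    refine Eq.trans ?_ (sum_card_bipartiteAbove_eq_sum_card_bipartiteBelow
      (fun (p : P) (m : L) => p ∈ m))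
    refine sum_congr rfl fun p _ => ?_
    rw [bipartiteAbove, filter_filter, tangentCount]
    simp only [and_comm]
  have h2 : ∑ p ∈ S with p ∈ l, tangentCount (L := L) S p = secantSize S l := by
    rw [secantSize, card_eq_sum_ones]
    exact sum_congr rfl fun p hp => tangentCount_eq_one h (mem_filter.1 hp).1
  rw [← h2, h1, h1, ← sum_add_distrib, ← card_tangents (L := L) h, card_eq_sum_ones]
  refine sum_congr rfl fun m hm => ?_
  have hlm : m ≠ l := by
    rintro rfl
    exact hl (mem_filter.1 hm).2
  obtain ⟨x, hx, hu⟩ := HasPoints.existsUnique_point P L m l hlm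
  rw [← card_union_of_disjoint, card_eq_one]
  · refine ⟨x, ?_⟩
    ext p
    simp only [mem_union, mem_filter, mem_univ, true_and, mem_singleton]
    constructor
    · rintro (hp | hp)
      · exact hu p ⟨hp.2, hp.1.1⟩
      · exact hu p ⟨hp.2, hp.1.2⟩
    · rintro rfl
      by_cases hp : p ∈ S
      · exact Or.inr ⟨⟨hp, hx.2⟩, hx.1⟩
      · exact Or.inl ⟨⟨hx.2, hp⟩, hx.1⟩
  · rw [disjoint_left]
    intro p hp hp'
    exact (mem_filter.1 (mem_filter.1 hp).1).2.2 (mem_filter.1 (mem_filter.1 hp').1).1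

/-- The lines of `M` that have pairwise distinct intersections with `l` can be blocked by about
half as many points off `l`. -/
theorem exists_blocking_points {l : L} (M : Finset L) (hl : ∀ m ∈ M, m ≠ l)
    (hM : ∀ m ∈ M, ∀ m' ∈ M, m ≠ m' → ∀ p : P, p ∈ l → p ∈ m → p ∉ m') :
    ∃ C : Finset P, 2 * #C ≤ #M + 1 ∧ (∀ p ∈ C, p ∉ l) ∧ ∀ m ∈ M, ∃ p ∈ C, p ∈ m := by
  induction M using Finset.strongInduction with
  | H M ih =>
  rcases M.eq_empty_or_nonempty with rfl | ⟨m, hm⟩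
  · exact ⟨∅, by simp⟩
  rcases (M.erase m).eq_empty_or_nonempty with h0 | ⟨m', hm'⟩
  · obtain ⟨p, hp, hpl⟩ : ∃ p : P, p ∈ m ∧ p ∉ l := by
      by_contra! hcon
      have h2 := ProjectivePlane.two_lt_pointCount P m
      rw [ProjectivePlane.pointCount_eq, ← card_points_on m] at h2
      obtain ⟨a, b, ha, hb, hab⟩ := one_lt_card_iff.1 (by omega : 1 < #{p : P | p ∈ m})
      have ha := (mem_filter.1 ha).2
      have hb := (mem_filter.1 hb).2
      exact hl m hm ((Nondegenerate.eq_or_eq ha hb (hcon a ha) (hcon b hb)).resolve_left hab)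
    refine ⟨{p}, ?_, ?_, fun x hx => ⟨p, mem_singleton_self p, ?_⟩⟩
    · have := card_pos.2 ⟨m, hm⟩
      rw [card_singleton]; omega
    · simpa using hpl
    · by_cases hxm : x = m
      · rwa [hxm]
      · exact absurd (mem_erase.2 ⟨hxm, hx⟩) (by simp [h0])
  · have hss : (M.erase m).erase m' ⊂ M :=
      (erase_subset _ _).trans_ssubset (erase_ssubset hm)
    obtain ⟨C, hC, hCl, hCM⟩ := ih _ hss (fun x hx => hl x (hss.1 hx))
      (fun x hx y hy => hM x (hss.1 hx) y (hss.1 hy))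
    have hm'M := mem_of_mem_erase hm'
    have hne := ne_of_mem_erase hm'
    -- The lines are blocked in pairs, each pair by its intersection point, which `hM` keeps off
    -- `l`.
    obtain ⟨p, hp, -⟩ := HasPoints.existsUnique_point P L m' m hne
    refine ⟨insert p C, ?_, ?_, fun x hx => ?_⟩
    · have h1 := card_insert_le p C
      have h2 := card_erase_add_one hm'
      have h3 := card_erase_add_one hm
      omega
    · intro y hy
      rcases mem_insert.1 hy with rfl | hy
      · exact fun hyl => hM m' hm'M m hm hne y hyl hp.1 hp.2
      · exact hCl y hy
    · by_cases h1 : x = m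
      · exact ⟨p, mem_insert_self _ _, h1 ▸ hp.2⟩
      by_cases h2 : x = m'
      · exact ⟨p, mem_insert_self _ _, h2 ▸ hp.1⟩
      obtain ⟨y, hy, hyx⟩ := hCM x (mem_erase.2 ⟨h2, mem_erase.2 ⟨h1, hx⟩⟩)
      exact ⟨y, mem_insert_of_mem hy, hyx⟩

end Counting

/-! ### Jamison's theorem by the polynomial method -/

section Jamison

open scoped Matrix

variable {K : Type*} [Field K]

theorem mem_iff_dotProduct (p l : ℙ K (Fin 3 → K)) : p ∈ l ↔ p.rep ⬝ᵥ l.rep = 0 := by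
  rw [ofField.mem_iff]
  conv_lhs => rw [← p.mk_rep, ← l.mk_rep]
  exact Projectivization.orthogonal_mk p.rep_nonzero l.rep_nonzero

/-- The linear form with coefficients `v`, as a polynomial. -/
noncomputable def linearForm (v : Fin 3 → K) : MvPolynomial (Fin 3) K :=
  ∑ i, MvPolynomial.C (v i) * MvPolynomial.X i

theorem eval_linearForm (v u : Fin 3 → K) : MvPolynomial.eval u (linearForm v) = v ⬝ᵥ u := by
  simp [linearForm, dotProduct]

theorem totalDegree_linearForm_le (v : Fin 3 → K) : (linearForm v).totalDegree ≤ 1 := by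
  refine MvPolynomial.totalDegree_finsetSum_le fun i _ => ?_
  refine (MvPolynomial.totalDegree_mul _ _).trans ?_
  simp

/-- Jamison's theorem: a set of points of the affine plane of order `q` that meets every line has
at least `2 * q - 1` points. The affine plane is the complement of the line `l`. -/
theorem card_affine_blocking_set [Fintype K] [DecidableEq K] (B : Finset (ℙ K (Fin 3 → K))) (l : ℙ K (Fin 3 → K))
    (hl : ∀ p ∈ B, p ∉ l) (hB : ∀ m : ℙ K (Fin 3 → K), m ≠ l → ∃ p ∈ B, p ∈ m) :
    2 * Fintype.card K ≤ #B + 1 := by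
  classical
  by_contra! hlt
  have : Fintype (ℙ K (Fin 3 → K)) := Fintype.ofFinite _
  have : Nontrivial (ℙ K (Fin 3 → K)) := by
    have h1 := ProjectivePlane.card_lines (ℙ K (Fin 3 → K)) (ℙ K (Fin 3 → K))
    have h2 := ProjectivePlane.one_lt_order (ℙ K (Fin 3 → K)) (ℙ K (Fin 3 → K))
    exact Fintype.one_lt_card_iff_nontrivial.1 (by omega)
  obtain ⟨m, hm⟩ := exists_ne l
  obtain ⟨b, hb, -⟩ := hB m hm
  have hbl : b.rep ⬝ᵥ l.rep ≠ 0 := fun h => hl b hb ((mem_iff_dotProduct b l).2 h)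
  have hq : 1 < Fintype.card K := Fintype.one_lt_card
  -- The first factor is the indicator of b · u = 1, which normalizes the lines missing `b`; on it
  -- the product vanishes at every line but `l`, since such a line meets `B` outside `b`.
  set f : MvPolynomial (Fin 3) K :=
    (1 - (linearForm b.rep - 1) ^ (Fintype.card K - 1)) * ∏ p ∈ B.erase b, linearForm p.rep
    with hf
  have hev : ∀ u, MvPolynomial.eval u f = (1 - (b.rep ⬝ᵥ u - 1) ^ (Fintype.card K - 1)) *
      ∏ p ∈ B.erase b, p.rep ⬝ᵥ u := by
    intro u
    simp [hf, eval_linearForm, map_prod]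
  -- The degree is at most (q - 1) + (#B - 1), and #B ≤ 2q - 2. Hence the values of `f` sum to 0,
  -- although only the one at `l` could be nonzero.
  have hdeg : f.totalDegree < (Fintype.card K - 1) * Fintype.card (Fin 3) := by
    have h1 : (1 - (linearForm b.rep - 1) ^ (Fintype.card K - 1)).totalDegree ≤
        Fintype.card K - 1 := by
      refine (MvPolynomial.totalDegree_sub _ _).trans (max_le (by simp) ?_)
      refine (MvPolynomial.totalDegree_pow _ _).trans ?_
      have : (linearForm b.rep - 1).totalDegree ≤ 1 :=
        (MvPolynomial.totalDegree_sub _ _).trans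
          (max_le (totalDegree_linearForm_le _) (by simp))
      simpa using Nat.mul_le_mul_left (Fintype.card K - 1) this
    have h2 : (∏ p ∈ B.erase b, linearForm p.rep).totalDegree ≤ #(B.erase b) := by
      refine (MvPolynomial.totalDegree_finsetProd _ _).trans ?_
      simpa using sum_le_card_nsmul (B.erase b) _ 1 fun p _ => totalDegree_linearForm_le p.rep
    have h3 := card_erase_add_one hb
    have h4 := MvPolynomial.totalDegree_mul (1 - (linearForm b.rep - 1) ^ (Fintype.card K - 1))
      (∏ p ∈ B.erase b, linearForm p.rep)
    rw [← hf] at h4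
    rw [Fintype.card_fin]
    omega
  set w : Fin 3 → K := (b.rep ⬝ᵥ l.rep)⁻¹ • l.rep with hw
  have hbw : b.rep ⬝ᵥ w = 1 := by
    rw [hw, dotProduct_smul, smul_eq_mul, inv_mul_cancel₀ hbl]
  have hsum := f.sum_eval_eq_zero hdeg
  rw [sum_eq_single w] at hsum
  · rw [hev, hbw, sub_self, zero_pow (by omega), sub_zero, one_mul, prod_eq_zero_iff] at hsum
    obtain ⟨p, hp, hpw⟩ := hsum
    rw [hw, dotProduct_smul, smul_eq_mul] at hpw
    refine hl p (mem_of_mem_erase hp) ((mem_iff_dotProduct p l).2 ?_)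
    exact (mul_eq_zero.1 hpw).resolve_left (inv_ne_zero hbl)
  · intro u _ huw
    rw [hev]
    by_cases hbu : b.rep ⬝ᵥ u = 1
    · have hu0 : u ≠ 0 := by
        rintro rfl
        simp at hbu
      refine mul_eq_zero_of_right _ (prod_eq_zero_iff.2 ?_)
      have hmem : ∀ p : ℙ K (Fin 3 → K), p ∈ Projectivization.mk K u hu0 ↔ p.rep ⬝ᵥ u = 0 := by
        intro p
        rw [ofField.mem_iff]
        conv_lhs => rw [← p.mk_rep]
        exact Projectivization.orthogonal_mk p.rep_nonzero hu0
      obtain ⟨p, hp, hpu⟩ := hB (Projectivization.mk K u hu0) (by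
        intro h
        rw [← l.mk_rep, Projectivization.mk_eq_mk_iff'] at h
        obtain ⟨a, ha⟩ := h
        apply huw
        rw [← ha, dotProduct_smul, smul_eq_mul] at hbu
        rw [← ha, hw, eq_inv_of_mul_eq_one_left hbu])
      rw [hmem] at hpu
      refine ⟨p, mem_erase.2 ⟨?_, hp⟩, hpu⟩
      rintro rfl
      exact one_ne_zero (hbu.symm.trans hpu)
    · rw [FiniteField.pow_card_sub_one_eq_one _ (sub_ne_zero.2 hbu), sub_self, zero_mul]
  · simp

end Jamison

/-! ### Bounds on secants, and sizes below 25 -/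

section LowerBound

open scoped Classical

/-- Jamison's theorem bounds the secants of a blocking semioval. -/
theorem secantSize_add_le {K : Type*} [Field K] [Fintype K]
    {S : Finset (ℙ K (Fin 3 → K))}
    (h : IsBlockingSemioval (ℙ K (Fin 3 → K)) (ℙ K (Fin 3 → K)) (S : Set (ℙ K (Fin 3 → K))))
    {l : ℙ K (Fin 3 → K)} (hl : secantSize S l ≠ 1) :
    secantSize S l + 4 * Fintype.card K ≤ 2 * #S + 3 := by
  have : Fintype (ℙ K (Fin 3 → K)) := Fintype.ofFinite _
  -- These tangents are the only lines other than `l` left unblocked when the points on `l` are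
  -- removed from S.
  set M : Finset (ℙ K (Fin 3 → K)) := {p ∈ S | p ∈ l}.biUnion fun p =>
    {m : ℙ K (Fin 3 → K) | p ∈ m ∧ secantSize S m = 1} with hM
  have hMmem : ∀ m, m ∈ M ↔ ∃ p ∈ S, p ∈ l ∧ IsTangentAt (S : Set (ℙ K (Fin 3 → K))) m p := by
    intro m
    simp only [hM, mem_biUnion, mem_filter, mem_univ, true_and, isTangentAt_iff]
    exact ⟨fun ⟨p, ⟨h1, h2⟩, h3⟩ => ⟨p, h1, h2, h1, h3⟩,
      fun ⟨p, h1, h2, _, h3⟩ => ⟨p, ⟨h1, h2⟩, h3⟩⟩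
  have hcard : #M ≤ secantSize S l := by
    refine card_biUnion_le.trans ?_
    rw [secantSize, card_eq_sum_ones]
    exact sum_le_sum fun p hp => (tangentCount_eq_one h.2 (mem_filter.1 hp).1).le
  have hne : ∀ m ∈ M, m ≠ l := by
    rintro m hm rfl
    obtain ⟨p, -, -, hp⟩ := (hMmem m).1 hm
    exact hl (isTangentAt_iff.1 hp).2.2
  have hpt : ∀ m ∈ M, ∀ p, p ∈ l → p ∈ m →
      p ∈ S ∧ IsTangentAt (S : Set (ℙ K (Fin 3 → K))) m p := by
    intro m hm p hpl hpm
    obtain ⟨x, hxS, hxl, hx⟩ := (hMmem m).1 hm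
    have hxp : p = x := (Nondegenerate.eq_or_eq hpl hxl hpm (isTangentAt_iff.1 hx).2.1).resolve_right
      (hne m hm).symm
    exact hxp ▸ ⟨hxS, hx⟩
  obtain ⟨C, hC, hCl, hCM⟩ := exists_blocking_points M hne (by
    intro m hm m' hm' hmm' p hpl hpm hpm'
    obtain ⟨hpS, h1⟩ := hpt m hm p hpl hpm
    exact hmm' ((h.2 p (mem_coe.2 hpS)).unique h1 (hpt m' hm' p hpl hpm').2))
  have hJ := card_affine_blocking_set ({p ∈ S | p ∉ l} ∪ C) l (by
    intro p hp
    rcases mem_union.1 hp with hp | hp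
    · exact (mem_filter.1 hp).2
    · exact hCl p hp) (by
    intro m hml
    by_cases hm : ∃ x ∈ S, x ∉ l ∧ x ∈ m
    · obtain ⟨x, hxS, hxl, hxm⟩ := hm
      exact ⟨x, mem_union_left _ (mem_filter.2 ⟨hxS, hxl⟩), hxm⟩
    push Not at hm
    obtain ⟨x, hxS, hxm⟩ := h.1.1 m
    have hxl : x ∈ l := by
      by_contra hxl
      exact hm x hxS hxl hxm
    obtain ⟨p, hp, hpm⟩ := hCM m ((hMmem m).2 ⟨x, hxS, hxl, by
      refine Set.ext fun y => ⟨fun hy => ?_, ?_⟩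
      · have hyl : y ∈ l := by
          by_contra hyl
          exact hm y hy.1 hyl hy.2
        exact (Nondegenerate.eq_or_eq hyl hxl hy.2 hxm).resolve_right (Ne.symm hml)
      · rintro rfl
        exact ⟨hxS, hxm⟩⟩)
    exact ⟨p, mem_union_right _ hp, hpm⟩)
  have h1 := card_union_le {p ∈ S | p ∉ l} C
  have h2 := card_filter_add_card_filter_not (s := S) (· ∈ l)
  rw [secantSize] at *
  omega

variable {P L : Type*} [Membership P L] [ProjectivePlane P L] [Fintype P] [Fintype L]

theorem card_points_on_off (S : Finset P) (l : L) :
    #{p : P | p ∈ l ∧ p ∉ S} + secantSize S l = ProjectivePlane.order P L + 1 := by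
  rw [← card_points_on l, ← card_filter_add_card_filter_not (s := {p : P | p ∈ l}) (· ∈ S),
    filter_filter, filter_filter, add_comm, secantSize]
  congr 2
  ext p
  simp [and_comm]

/-- The points off `S` on a long secant lie on many tangents. -/
theorem secantSize_mul_le {S : Finset P} (hS : ∀ l : L, 1 ≤ secantSize S l)
    (h : IsSemioval P L (S : Set P)) {l : L} (hl : secantSize S l ≠ 1) :
    #{p : P | p ∈ l ∧ p ∉ S} * (secantSize S l - 2 + 2 * (ProjectivePlane.order P L + 1)) +
      secantSize S l ≤ (#{p : P | p ∈ l ∧ p ∉ S} + 1) * #S := by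
  have h1 : ∑ p : P with p ∈ l ∧ p ∉ S, (secantSize S l - 2 + 2 * (ProjectivePlane.order P L + 1))
      ≤ ∑ p : P with p ∈ l ∧ p ∉ S, (#S + tangentCount (L := L) S p) :=
    sum_le_sum fun p hp => excess_le hS (mem_filter.1 hp).2.2 (mem_filter.1 hp).2.1
  rw [sum_const, smul_eq_mul, sum_add_distrib (f := fun _ => #S), sum_const, smul_eq_mul] at h1
  have h2 := sum_tangentCount h hl
  linarith

theorem twentyfive_le_card {S : Finset P} (hq : ProjectivePlane.order P L = 11)
    (hS : ∀ l : L, 1 ≤ secantSize S l) (h : IsSemioval P L (S : Set P))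
    (hJ : ∀ l : L, secantSize S l ≠ 1 → secantSize S l + 41 ≤ 2 * #S) :
    25 ≤ #S := by
  by_contra! hk
  have hcl : Fintype.card L = 133 := by simp [ProjectivePlane.card_lines P L, hq]
  have h1 := sum_excess hS h
  have h2 := sum_excess_sq hS h
  rw [hcl, hq] at h1 h2
  -- The excesses sum to 13k - 266 and their squares to k² - 38k + 532. For k = 24 these are 46 and
  -- 196, and 196 > 4 · 46.
  have key : ∀ j, (∀ l : L, secantSize S l - 2 ≤ j) →
      ∑ l : L, (secantSize S l - 2) ^ 2 ≤ j * ∑ l : L, (secantSize S l - 2) := by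
    intro j hj
    rw [mul_sum]
    exact sum_le_sum fun l _ => by rw [sq]; exact Nat.mul_le_mul_right _ (hj l)
  rcases Nat.lt_or_ge #S 24 with hk' | hk'
  · have := key 3 fun l => by
      by_cases hl : secantSize S l = 1
      · omega
      · have := hJ l hl
        omega
    generalize #S = k at *
    interval_cases k <;> omega
  · have hk24 : #S = 24 := by omega
    have := key 4 fun l => by
      by_cases hl : secantSize S l = 1
      · omega
      have h3 := hJ l hl
      have h4 := secantSize_mul_le hS h hl
      have h5 := card_points_on_off S l
      rw [hk24] at h3 h4
      rw [hq] at h4 h5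
      by_contra! hlt
      have h6 : secantSize S l = 7 := by omega
      have h7 : #{p : P | p ∈ l ∧ p ∉ S} = 5 := by omega
      rw [h6, h7] at h4
      omega
    rw [hk24] at h1 h2
    omega

/-! ### Size 25 -/

section CardTwentyFive

variable {S : Finset P}

theorem secantSize_le_six (hq : ProjectivePlane.order P L = 11)
    (hS : ∀ l : L, 1 ≤ secantSize S l) (h : IsSemioval P L (S : Set P))
    (hJ : ∀ l : L, secantSize S l ≠ 1 → secantSize S l + 41 ≤ 2 * #S)
    (hk : #S = 25) (l : L) : secantSize S l ≤ 6 := by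
  by_contra! hlt
  have hl : secantSize S l ≠ 1 := by omega
  have h3 := hJ l hl
  have h4 := secantSize_mul_le hS h hl
  have h5 := card_points_on_off S l
  rw [hk] at h3 h4
  rw [hq] at h4 h5
  obtain ⟨a, ha⟩ : ∃ a, #{p : P | p ∈ l ∧ p ∉ S} = a := ⟨_, rfl⟩
  rw [ha] at h4 h5
  generalize secantSize S l = m at *
  have h9 : m ≤ 9 := by omega
  obtain rfl : a = 12 - m := by omega
  interval_cases m <;> omega

/-- A common point off S would have excess at least 8, hence at least 7 tangents. The other five
points of `l` off S have at least 3 each, making 22, but only 25 - 6 = 19 tangents meet `l` off S.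
-/
theorem exists_mem_of_six_secants (hq : ProjectivePlane.order P L = 11)
    (hS : ∀ l : L, 1 ≤ secantSize S l) (h : IsSemioval P L (S : Set P))
    (hk : #S = 25) {l m : L} (hl : secantSize S l = 6) (hm : secantSize S m = 6) (hlm : l ≠ m) :
    ∃ p ∈ S, p ∈ l ∧ p ∈ m := by
  obtain ⟨p, ⟨hpl, hpm⟩, -⟩ := HasPoints.existsUnique_point P L l m hlm
  by_contra! hcon
  have hp : p ∉ S := fun hp => hcon p hp hpl hpm
  have h1 := sum_excess_through hS p
  have h2 : ∑ n ∈ ({l, m} : Finset L), (secantSize S n - 2) ≤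
      ∑ n : L with p ∈ n, (secantSize S n - 2) :=
    sum_le_sum_of_subset (by
      intro n hn
      rcases mem_insert.1 hn with rfl | hn
      · simpa using hpl
      · rw [mem_singleton] at hn
        simpa [hn] using hpm)
  rw [sum_pair hlm, hl, hm] at h2
  rw [if_neg hp, hq, hk] at h1
  have hmem : p ∈ ({p : P | p ∈ l ∧ p ∉ S} : Finset P) := by simp [hpl, hp]
  have h3 := sum_tangentCount h (by omega : secantSize S l ≠ 1)
  rw [← add_sum_erase _ _ hmem, hk, hl] at h3
  have h4 := card_points_on_off S l
  have h5 := card_erase_add_one hmem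
  have h6 := card_nsmul_le_sum (({p : P | p ∈ l ∧ p ∉ S} : Finset P).erase p)
    (fun p => tangentCount (L := L) S p) 3 (by
      intro x hx
      have hx := mem_filter.1 (mem_of_mem_erase hx)
      have := excess_le hS hx.2.2 hx.2.1
      rw [hq, hk, hl] at this
      omega)
  rw [smul_eq_mul] at h6
  rw [hq, hl] at h4
  omega

/-- Counts ordered pairs of 6-secants by their common points in S: one for distinct lines, six for
equal ones. -/
theorem sum_six_secants_sq (hq : ProjectivePlane.order P L = 11)
    (hS : ∀ l : L, 1 ≤ secantSize S l) (h : IsSemioval P L (S : Set P)) (hk : #S = 25) :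
    ∑ p ∈ S, #{l : L | p ∈ l ∧ secantSize S l = 6} ^ 2 =
      #{l : L | secantSize S l = 6} * (#{l : L | secantSize S l = 6} + 5) := by
  set T : Finset L := {l : L | secantSize S l = 6} with hT
  have h1 : ∀ p, #{l : L | p ∈ l ∧ secantSize S l = 6} = #{l ∈ T | p ∈ l} := by
    intro p
    rw [hT, filter_filter]
    simp only [and_comm]
  have h2 : ∀ l ∈ T, ∀ m ∈ T, #{p ∈ {p ∈ S | p ∈ l} | p ∈ m} = 1 + if l = m then 5 else 0 := by
    intro l hl m hm
    have hl6 : secantSize S l = 6 := (mem_filter.1 hl).2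
    have hm6 : secantSize S m = 6 := (mem_filter.1 hm).2
    split_ifs with hlm
    · subst hlm
      rw [filter_filter]
      simpa [secantSize] using hl6
    · obtain ⟨p, hpS, hpl, hpm⟩ := exists_mem_of_six_secants hq hS h hk hl6 hm6 hlm
      rw [add_zero, card_eq_one]
      refine ⟨p, ext fun x => ?_⟩
      simp only [mem_filter, mem_singleton]
      constructor
      · rintro ⟨⟨-, hxl⟩, hxm⟩
        exact (Nondegenerate.eq_or_eq hxl hpl hxm hpm).resolve_right hlm
      · rintro rfl
        exact ⟨⟨hpS, hpl⟩, hpm⟩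
  calc ∑ p ∈ S, #{l : L | p ∈ l ∧ secantSize S l = 6} ^ 2
      = ∑ p ∈ S, ∑ l ∈ T with p ∈ l, #{l ∈ T | p ∈ l} :=
        sum_congr rfl fun p _ => by rw [h1, sum_const, smul_eq_mul, sq]
    _ = ∑ l ∈ T, ∑ p ∈ S with p ∈ l, #{l ∈ T | p ∈ l} :=
        sum_comm' (by simp only [mem_filter]; tauto)
    _ = ∑ l ∈ T, ∑ m ∈ T, #{p ∈ {p ∈ S | p ∈ l} | p ∈ m} :=
        sum_congr rfl fun l _ => (sum_card_bipartiteAbove_eq_sum_card_bipartiteBelow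
          (fun (p : P) (m : L) => p ∈ m))
    _ = ∑ l ∈ T, ∑ m ∈ T, (1 + if l = m then 5 else 0) :=
        sum_congr rfl fun l hl => sum_congr rfl fun m hm => h2 l hl m hm
    _ = #T * (#T + 5) := by
        rw [← smul_eq_mul, ← sum_const]
        refine sum_congr rfl fun l hl => ?_
        rw [sum_add_distrib, sum_ite_eq, if_pos hl, ← card_eq_sum_ones]

/-- Let T be the number of 6-secants and Nᵢ the number of points of S on exactly i of them. The
incidence counts give 3N₃ = T(T - 7) + N₁ and 2(N₀ + N₃) = T² - 13T + 50, while N₃ is at most three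
times the number of 3-secants. The two excess sums, 59 and 207, contradict this for every T. -/
theorem card_ne_twentyfive (hq : ProjectivePlane.order P L = 11)
    (hS : ∀ l : L, 1 ≤ secantSize S l) (h : IsSemioval P L (S : Set P))
    (hJ : ∀ l : L, secantSize S l ≠ 1 → secantSize S l + 41 ≤ 2 * #S) :
    #S ≠ 25 := by
  intro hk
  have h6 := secantSize_le_six hq hS h hJ hk
  have hcl : Fintype.card L = 133 := by simp [ProjectivePlane.card_lines P L, hq]
  have e1 := sum_excess hS h
  have e2 := sum_excess_sq hS h
  rw [hcl, hq, hk] at e1 e2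
  have c1 : ∀ M : Finset L, ∑ l ∈ M, (secantSize S l - 2) = #{l ∈ M | secantSize S l = 3} +
      2 * #{l ∈ M | secantSize S l = 4} + 3 * #{l ∈ M | secantSize S l = 5} +
      4 * #{l ∈ M | secantSize S l = 6} := by
    intro M
    simp only [card_filter, mul_sum, ← sum_add_distrib]
    refine sum_congr rfl fun l _ => ?_
    have := h6 l
    interval_cases secantSize S l <;> rfl
  have c2 : ∑ l : L, (secantSize S l - 2) ^ 2 = #{l : L | secantSize S l = 3} +
      4 * #{l : L | secantSize S l = 4} + 9 * #{l : L | secantSize S l = 5} +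
      16 * #{l : L | secantSize S l = 6} := by
    simp only [card_filter, mul_sum, ← sum_add_distrib]
    refine sum_congr rfl fun l _ => ?_
    have := h6 l
    interval_cases secantSize S l <;> rfl
  rw [c1] at e1 e2
  rw [c2] at e2
  set s : P → ℕ := fun p => #{l : L | p ∈ l ∧ secantSize S l = 6} with hs
  set t : P → ℕ := fun p => #{l : L | p ∈ l ∧ secantSize S l = 3} with ht
  -- The excess at a point of S is 25 + 11 + 1 - 24 = 13; three 6-secants use 12, and the remaining
  -- 1 needs a 3-secant.
  have hst : ∀ p ∈ S, s p ≤ 3 ∧ (s p = 3 → 1 ≤ t p) := by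
    intro p hp
    have h1 := sum_excess_through hS p
    rw [if_pos hp, tangentCount_eq_one h hp, hq, hk, c1] at h1
    simp only [filter_filter] at h1
    simp only [hs, ht]
    omega
  have a0 : #S = #{p ∈ S | s p = 0} + #{p ∈ S | s p = 1} + #{p ∈ S | s p = 2} +
      #{p ∈ S | s p = 3} := by
    rw [card_eq_sum_ones S]
    simp only [card_filter, ← sum_add_distrib]
    refine sum_congr rfl fun p hp => ?_
    have := (hst p hp).1
    interval_cases s p <;> rfl
  have a1 : ∑ p ∈ S, s p = #{p ∈ S | s p = 1} + 2 * #{p ∈ S | s p = 2} +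
      3 * #{p ∈ S | s p = 3} := by
    simp only [card_filter, mul_sum, ← sum_add_distrib]
    refine sum_congr rfl fun p hp => ?_
    have := (hst p hp).1
    interval_cases s p <;> rfl
  have a2 : ∑ p ∈ S, s p ^ 2 = #{p ∈ S | s p = 1} + 4 * #{p ∈ S | s p = 2} +
      9 * #{p ∈ S | s p = 3} := by
    simp only [card_filter, mul_sum, ← sum_add_distrib]
    refine sum_congr rfl fun p hp => ?_
    have := (hst p hp).1
    interval_cases s p <;> rfl
  have a3 : #{p ∈ S | s p = 3} ≤ ∑ p ∈ S, t p := by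
    rw [card_filter]
    refine sum_le_sum fun p hp => ?_
    split_ifs with h3
    · exact (hst p hp).2 h3
    · exact Nat.zero_le _
  have b6 : ∑ p ∈ S, s p = #{l : L | secantSize S l = 6} * 6 := sum_card_secants_through S 6
  have b3 : ∑ p ∈ S, t p = #{l : L | secantSize S l = 3} * 3 := sum_card_secants_through S 3
  have bb : ∑ p ∈ S, s p ^ 2 = _ := sum_six_secants_sq hq hS h hk
  have hT : #{l : L | secantSize S l = 6} ≤ 14 := by omega
  generalize #{l : L | secantSize S l = 6} = T at *
  interval_cases T <;> omega

end CardTwentyFive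

end LowerBound

/-! ### The lower bound in PG(2,11) -/

theorem PG211.order_eq : ProjectivePlane.order PG211.Point PG211.Line = 11 := by
  have : Fintype PG211.Point := Fintype.ofFinite _
  have h1 := ProjectivePlane.card_points PG211.Point PG211.Line
  rw [← Nat.card_eq_fintype_card, Projectivization.card_of_finrank (ZMod 11) _ (n := 3) (by simp),
    Nat.card_zmod] at h1
  norm_num [sum_range_succ] at h1
  nlinarith

theorem twentysix_le_card {S : Finset PG211.Point}
    (h : IsBlockingSemioval PG211.Point PG211.Line (S : Set PG211.Point)) : 26 ≤ #S := by
  classical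
  have : Fintype PG211.Point := Fintype.ofFinite _
  have hS : ∀ l : PG211.Line, 1 ≤ secantSize S l := by
    intro l
    obtain ⟨x, hxS, hxl⟩ := h.1.1 l
    exact card_pos.2 ⟨x, mem_filter.2 ⟨hxS, hxl⟩⟩
  have hJ : ∀ l : PG211.Line, secantSize S l ≠ 1 → secantSize S l + 41 ≤ 2 * #S := by
    intro l hl
    have := secantSize_add_le h hl
    rw [ZMod.card] at this
    omega
  have h1 := twentyfive_le_card PG211.order_eq hS h.2 hJ
  have h2 := card_ne_twentyfive PG211.order_eq hS h.2 hJ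
  omega

/-! ### A blocking semioval with 26 points -/

section Example

/-- Homogeneous coordinates of the points of a blocking semioval in `PG(2,11)`. -/
def semiovalCoords : Fin 26 → Fin 3 → ZMod 11 :=
  ![![0, 1, 0], ![1, 6, 4], ![1, 8, 7], ![1, 7, 6], ![1, 0, 9], ![0, 1, 1], ![1, 1, 7],
    ![1, 3, 9], ![1, 9, 4], ![1, 0, 6], ![0, 1, 2], ![1, 7, 10], ![1, 5, 6], ![1, 2, 0],
    ![1, 0, 7], ![1, 1, 6], ![1, 8, 6], ![1, 9, 7], ![1, 2, 7], ![1, 10, 1], ![1, 1, 9],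
    ![1, 4, 4], ![1, 9, 3], ![1, 3, 2], ![1, 6, 8], ![1, 2, 8]]

/-- Homogeneous coordinates of the tangents of the blocking semioval. -/
def tangentCoords : Fin 26 → Fin 3 → ZMod 11 :=
  ![![1, 0, 2], ![1, 10, 4], ![1, 8, 8], ![1, 7, 10], ![1, 9, 6], ![1, 3, 8], ![0, 1, 3],
    ![1, 1, 2], ![1, 8, 1], ![1, 7, 9], ![1, 9, 1], ![1, 10, 5], ![1, 2, 0], ![1, 5, 1],
    ![1, 6, 3], ![0, 1, 9], ![1, 6, 1], ![1, 3, 7], ![1, 4, 5], ![1, 1, 0], ![1, 9, 5],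
    ![1, 8, 0], ![1, 7, 8], ![1, 6, 7], ![1, 2, 8], ![1, 10, 7]]

theorem semiovalCoords_ne_zero : ∀ i, semiovalCoords i ≠ 0 := by decide +kernel

theorem tangentCoords_ne_zero : ∀ i, tangentCoords i ≠ 0 := by decide +kernel

theorem smul_semiovalCoords_ne :
    ∀ i j, i ≠ j → ∀ a : ZMod 11, a • semiovalCoords j ≠ semiovalCoords i := by decide +kernel

theorem semiovalCoords_dotProduct_tangentCoords :
    ∀ i j, semiovalCoords j ⬝ᵥ tangentCoords i = 0 ↔ j = i := by decide +kernel

/-- Every line of the plane contains a point of the blocking semioval, is a tangent if it contains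
no other one, and contains less than twelve of them. -/
def LineCondition (u : Fin 3 → ZMod 11) : Prop :=
  (∃ i, semiovalCoords i ⬝ᵥ u = 0 ∧
    (u = tangentCoords i ∨ ∃ j, j ≠ i ∧ semiovalCoords j ⬝ᵥ u = 0)) ∧
  #{i | semiovalCoords i ⬝ᵥ u = 0} < 12

instance : DecidablePred LineCondition := fun u => by
  unfold LineCondition
  infer_instance

theorem lineCondition_one : ∀ b c, LineCondition ![1, b, c] := by decide +kernel

theorem lineCondition_zero_one : ∀ c, LineCondition ![0, 1, c] := by decide +kernel

theorem lineCondition_zero_zero_one : LineCondition ![0, 0, 1] := by decide +kernel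

/-- Scaling the first nonzero coordinate to 1 leaves three finite families to check. `tangentCoords`
is scaled the same way, so equality of vectors there detects equality of lines. -/
theorem exists_lineCondition (l : PG211.Line) :
    ∃ u, ∃ hu : u ≠ 0, l = Projectivization.mk (ZMod 11) u hu ∧ LineCondition u := by
  have key : ∀ (u : Fin 3 → ZMod 11) (a : ZMod 11), a ≠ 0 → a • u = l.rep → LineCondition u →
      ∃ u, ∃ hu : u ≠ 0, l = Projectivization.mk (ZMod 11) u hu ∧ LineCondition u := by
    intro u a ha h hu
    have hu0 : u ≠ 0 := by
      rintro rfl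
      exact l.rep_nonzero (by rw [← h, smul_zero])
    refine ⟨u, hu0, ?_, hu⟩
    conv_lhs => rw [← l.mk_rep]
    exact (Projectivization.mk_eq_mk_iff' _ _ _ _ _).2 ⟨a, h⟩
  by_cases h0 : l.rep 0 = 0
  · by_cases h1 : l.rep 1 = 0
    · have h2 : l.rep 2 ≠ 0 := by
        intro h2
        apply l.rep_nonzero
        ext i
        fin_cases i <;> simpa
      refine key _ _ h2 ?_ lineCondition_zero_zero_one
      ext i
      fin_cases i <;> simp [h0, h1]
    · refine key _ _ h1 ?_ (lineCondition_zero_one ((l.rep 1)⁻¹ * l.rep 2))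
      ext i
      fin_cases i <;> simp [h0, mul_inv_cancel_left₀ h1]
  · refine key _ _ h0 ?_ (lineCondition_one ((l.rep 0)⁻¹ * l.rep 1) ((l.rep 0)⁻¹ * l.rep 2))
    ext i
    fin_cases i <;> simp [mul_inv_cancel_left₀ h0]

/-- The points of a blocking semioval in `PG(2,11)`. -/
def semiovalPoint (i : Fin 26) : PG211.Point :=
  Projectivization.mk (ZMod 11) (semiovalCoords i) (semiovalCoords_ne_zero i)

theorem semiovalPoint_injective : Function.Injective semiovalPoint := by
  intro i j hij
  by_contra hne
  obtain ⟨a, ha⟩ := (Projectivization.mk_eq_mk_iff' _ _ _ _ _).1 hij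
  exact smul_semiovalCoords_ne i j hne a ha

theorem semiovalPoint_mem_iff {i : Fin 26} {u : Fin 3 → ZMod 11} (hu : u ≠ 0) :
    semiovalPoint i ∈ (Projectivization.mk (ZMod 11) u hu : PG211.Line) ↔
      semiovalCoords i ⬝ᵥ u = 0 :=
  (ofField.mem_iff _ _).trans (Projectivization.orthogonal_mk _ hu)

theorem isTangentAt_semiovalPoint {i : Fin 26} {u : Fin 3 → ZMod 11} (hu : u ≠ 0) :
    IsTangentAt (Set.range semiovalPoint) (Projectivization.mk (ZMod 11) u hu : PG211.Line)
      (semiovalPoint i) ↔ ∀ j, semiovalCoords j ⬝ᵥ u = 0 ↔ j = i := by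
  simp only [IsTangentAt, Set.ext_iff, Set.mem_ofPred_eq, Set.mem_singleton_iff]
  constructor
  · intro h j
    rw [← semiovalPoint_mem_iff hu, ← semiovalPoint_injective.eq_iff, ← h]
    simp
  · intro h x
    constructor
    · rintro ⟨⟨j, rfl⟩, hj⟩
      rw [(h j).1 ((semiovalPoint_mem_iff hu).1 hj)]
    · rintro rfl
      exact ⟨⟨i, rfl⟩, (semiovalPoint_mem_iff hu).2 ((h i).2 rfl)⟩

theorem isBlockingSemioval_range_semiovalPoint :
    IsBlockingSemioval PG211.Point PG211.Line (Set.range semiovalPoint) := by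
  classical
  refine ⟨⟨fun l => ?_, fun l => ?_⟩, ?_⟩
  · obtain ⟨u, hu, rfl, ⟨i, hi, -⟩, -⟩ := exists_lineCondition l
    exact ⟨_, ⟨i, rfl⟩, (semiovalPoint_mem_iff hu).2 hi⟩
  · obtain ⟨u, hu, rfl, -, h12⟩ := exists_lineCondition l
    have : Fintype PG211.Point := Fintype.ofFinite _
    -- A line has 12 points, and fewer than 12 of them are in the set.
    by_contra! hcon
    have h1 := card_points_on (P := PG211.Point) (Projectivization.mk (ZMod 11) u hu : PG211.Line)
    rw [PG211.order_eq] at h1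
    have h2 : ({p : PG211.Point | p ∈ (Projectivization.mk (ZMod 11) u hu : PG211.Line)} :
        Finset PG211.Point) ⊆ ({i | semiovalCoords i ⬝ᵥ u = 0} : Finset _).image semiovalPoint := by
      intro p hp
      have hp := (mem_filter.1 hp).2
      obtain ⟨i, rfl⟩ := hcon p hp
      exact mem_image_of_mem _ (mem_filter.2 ⟨mem_univ i, (semiovalPoint_mem_iff hu).1 hp⟩)
    have h3 := (card_le_card h2).trans card_image_le
    omega
  · rintro _ ⟨i, rfl⟩
    refine ⟨Projectivization.mk (ZMod 11) (tangentCoords i) (tangentCoords_ne_zero i),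
      (isTangentAt_semiovalPoint _).2 (semiovalCoords_dotProduct_tangentCoords i), fun l hl => ?_⟩
    obtain ⟨u, hu, rfl, ⟨j, hj, hju⟩, -⟩ := exists_lineCondition l
    rw [isTangentAt_semiovalPoint] at hl
    obtain rfl := (hl j).1 hj
    rcases hju with rfl | ⟨k, hk, hku⟩
    · rfl
    · exact absurd ((hl k).1 hku) hk

end Example

/-- There is no blocking semioval with exactly 25 points in `PG(2,11)`, and 26 is the least size of
a blocking semioval in `PG(2,11)`. -/
theorem mainTheorem1 :
    (¬ ∃ S : Set PG211.Point,
      IsBlockingSemioval PG211.Point PG211.Line S ∧ S.ncard = 25) ∧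
    IsLeast {n : ℕ | ∃ S : Set PG211.Point,
      IsBlockingSemioval PG211.Point PG211.Line S ∧ S.ncard = n} 26 := by
  have key : ∀ S : Set PG211.Point, IsBlockingSemioval PG211.Point PG211.Line S →
      26 ≤ S.ncard := by
    intro S hS
    obtain ⟨S, rfl⟩ := S.toFinite.exists_finset_coe
    rw [Set.ncard_coe_finset]
    exact twentysix_le_card hS
  refine ⟨?_, ?_, ?_⟩
  · rintro ⟨S, hS, hcard⟩
    have := key S hS
    omega
  · exact ⟨_, isBlockingSemioval_range_semiovalPoint, by
      rw [Set.ncard_range_of_injective semiovalPoint_injective, Nat.card_fin]⟩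
  · rintro n ⟨S, hS, rfl⟩
    exact key S hS
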